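/- **Theorem (Adam-Hash: adaptive and dynamic hashing-based estimator).** *Setting.* Let $d\ge 1$, let $B^d=\{q\in\mathbb R^d:\|q\|_2\le 1\}$ and $S^{d-1}$ be the unit ball and the unit sphere, and let $w(q,x)$ be a target function with $w(q,x)\in[0,1]$ and $|w(q,x)-w(q',x)|\le k\|q-q'\|_2$ for all $q,q'\in B^d$, $x\in S^{d-1}$ (convexity of $w$ is not needed). For a finite nonempty data set $X$ of points of $S^{d-1}$ (repetitions allowed) put $\mu_X(q)=\frac1{|X|}\sum_{x\in X}w(q,x)$. A hashing scheme is a random pair of functions $(h,g)$, for data points and for queries ($h=g$ is allowed), with collision probability $p(q,x)=\Pr[h(x)=g(q)]$. Given hashing schemes $\mathcal H_1,\dots,\mathcal H_G$, draw independently $(h_i,g_i)\sim\mathcal H_i$, let $H_i(q)=\{x\in X: h_i(x)=g_i(q)\}$, let $y_i$ be a uniformly random element of $H_i(q)$, and put $\tilde w_i=p_i^2/\sum_{l}p_l^2$. The multi-resolution estimator is $$Z_X(q)=\frac1{|X|}\sum_{i=1}^G\frac{\tilde w_i(q,y_i)\,w(q,y_i)}{p_i(q,y_i)}\,|H_i(q)|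 ,$$ where empty buckets contribute $0$. Assume that it is $V$-bounded for a function $V:\mathbb R\to\mathbb R_{\ge0}$: on $(0,1]$, $V$ is non-increasing and $\mu\mapsto\mu^2V(\mu)$ is non-decreasing, and for all such $X$ and all $q\in B^d$, $\mathbb E[Z_X(q)]=\mu_X(q)$ and $\mathrm{Var}[Z_X(q)]\le\mu_X(q)^2V(\mu_X(q))$. Assume that it has complexity $C$: drawing its hash functions, inserting a point into or deleting a point from its hash tables, and evaluating it once take at most $C$ steps each. In the step count, an arithmetic operation, a dictionary operation on a hash table, and picking an element of a bucket by its index cost one step, selecting the median of $j$ numbers costs $j$ steps, and evaluating hash functions, collision probabilities and $w$ has costs given with the input. *The data structure.* It keeps $L$ independent multi-resolution HBEs. Each of them consists of $R=B\cdot m$ independent copies of the estimator, in $B$ groups of $m$, with their hash tables. All random choices, including those that pick the elements of the buckets, are made at initialization. Insertions and deletions of data points update the hash tables. A query $q$ is moved to a point $p$ of an $\varepsilon_0$-net of $B^d$ with $\|p-q\|_2\le\varepsilon_0$ (for instance, a nearest one). Each HBE computes the median over its groups of the mean of the estimates at $p$, replaced by $0$ if it is less than $(1-\varepsilon/2)\tau$.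 The answer $\hat Z(q)$ is the median of the $L$ values. *Claim.* For every $\delta_0<1$ there is a constant $c>0$ such that for all $d\ge1$, $\varepsilon,\tau\in(0,1)$, $\delta\in(0,\delta_0]$, $k\ge\varepsilon\tau$ and $V$ with $V(\tau)\ge\varepsilon^2$ there are $\varepsilon_0\in(0,\varepsilon\tau/k]$ and sizes $$L\le c\,\Lambda,\qquad R=Bm\le c\,\varepsilon^{-2}V(\tau)\log(1/\delta),\qquad\text{where }\ \Lambda=\log\!\big((10k/(\varepsilon\tau))^d/\delta\big),$$ such that for all $w$ and all schemes $\mathcal H_1,\dots,\mathcal H_G$ as above, and for every $\varepsilon_0$-net $N\subset B^d$ of $B^d$ with $|N|\le(10/\varepsilon_0)^d$, the following holds. 1. (Correctness.) Fix nonempty initial data on $S^{d-1}$ and a sequence of insertions and deletions of points of $S^{d-1}$ (deleting an absent point has no effect), with resulting data set $X\neq\emptyset$. With probability at least $1-\delta$, simultaneously for all queries $q\in B^d$, with $\mu=\mu_X(q)$: * if $\mu\ge\tau$, then $|\hat Z(q)-\mu|\le\varepsilon\mu$; * if $\mu<\tau$, then $\hat Z(q)=0$ or $|\hat Z(q)-\mu|\le\varepsilon\mu$;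 * if $\mu<(1-\varepsilon)\tau$, then $\hat Z(q)=0$. In particular, with probability at least $1-\delta$ all the answers to an arbitrarily long sequence of queries in $B^d$ are correct in this sense, even when an adversary chooses each query depending on all the previous answers. 2. (Running times, in the worst case over the random choices.) Initialization with $n\ge1$ points takes at most $c\,\varepsilon^{-2}V(\tau)\,C\log(1/\delta)\,n\,\Lambda$ steps. An insertion, a deletion, and a query each take at most $c\,\varepsilon^{-2}V(\tau)\,C\log(1/\delta)\,\Lambda$ steps, where for a query the time for locating $p$ is included if it is at most $d$, and has to be added otherwise. Moreover, a net as required exists in which $p$ is found in $d$ steps: round each coordinate of $q$ towards zero to a multiple of $\varepsilon_0/\sqrt d$. -/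

import Mathlib

open MeasureTheory

noncomputable section

/-! ### Computations with a step count -/

/-- The result of a computation together with the number of elementary steps it has taken. -/
structure Timed (α : Type) where
  val : α
  cost : ℕ

namespace Timed

instance : Monad Timed where
  pure a := ⟨a, 0⟩
  bind x f := ⟨(f x.val).val, x.cost + (f x.val).cost⟩

/-- Spend `n` elementary steps. -/
def tick (n : ℕ) : Timed Unit := ⟨(), n⟩

/-- A loop over a finite index set: run all the computations `f i` and collect the results;
the costs add up. -/
def loop {ι : Type} [Fintype ι] {β : ι → Type} (f : ∀ i, Timed (β i)) : Timed (∀ i, β i) :=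
  ⟨fun i => (f i).val, ∑ i, (f i).cost⟩

end Timed

/-- The median of `n` numbers: the entry of rank `⌊n / 2⌋` (counted from `0`) in sorted order. -/
def median {n : ℕ} (v : Fin n → ℝ) : ℝ :=
  if h : 0 < n then v (Tuple.sort v ⟨n / 2, Nat.div_lt_self h one_lt_two⟩) else 0

/-! ### Hashing schemes and the multi-resolution estimator -/

/-- Points of `ℝ^d` with the Euclidean norm. -/
abbrev Pt (d : ℕ) : Type := EuclideanSpace ℝ (Fin d)

/-- A (possibly asymmetric) hashing scheme on `ℝ^d`: a random pair of hash functions, the first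
one for data points and the second one for queries, determined by a random seed.  A symmetric
scheme has `dataHash = queryHash`.  The three numbers are the times for drawing a pair of hash
functions, for evaluating one of them at a point, and for evaluating the collision probability at
a pair of points. -/
structure HashScheme (d : ℕ) where
  Seed : Type
  [seedSpace : MeasurableSpace Seed]
  law : Measure Seed
  [isProbabilityMeasure : IsProbabilityMeasure law]
  Key : Type
  dataHash : Seed → Pt d → Key
  queryHash : Seed → Pt d → Key
  measurableSet_collision : ∀ x q, MeasurableSet {s | dataHash s x = queryHash s q}
  drawCost : ℕ
  hashCost : ℕ
  probCost : ℕ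

attribute [instance] HashScheme.seedSpace HashScheme.isProbabilityMeasure

/-- The collision probability of a data point `x` and a query `q`. -/
def HashScheme.collisionProb {d : ℕ} (S : HashScheme d) (q x : Pt d) : ℝ :=
  S.law.real {s | S.dataHash s x = S.queryHash s q}

/-- A target function `w (query) (data point)`, with the time for evaluating it. -/
structure Target (d : ℕ) where
  w : Pt d → Pt d → ℝ
  evalCost : ℕ

section Estimator

variable {d G : ℕ} (H : Fin G → HashScheme d)

/-- The weight `p_g² / ∑ i, p_i²` of the `g`-th scheme. -/
def hashWeight (g : Fin G) (q x : Pt d) : ℝ :=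
  (H g).collisionProb q x ^ 2 / ∑ i, (H i).collisionProb q x ^ 2

/-- The randomness of one multi-resolution estimator: for every scheme the seed of a pair of hash
functions, and a uniform number in `[0, 1]` used for picking a random element of a bucket. -/
abbrev DrawSeed : Type := ∀ g, (H g).Seed × unitInterval

/-- The `G` schemes (and the uniform numbers) are drawn independently. -/
def drawLaw : Measure (DrawSeed H) :=
  Measure.pi fun g => (H g).law.prod (volume : Measure unitInterval)

/-- The hash tables of one multi-resolution estimator: for every scheme a dictionary that maps a
hash value to the bucket of the data points with this hash value. -/
abbrev Tables : Type := ∀ g, (H g).Key → List (Pt d)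

variable {H}

/-- Draw `G` pairs of hash functions, starting from empty tables. -/
def Tables.empty : Timed (Tables H) := do
  Timed.tick (∑ g, ((H g).drawCost + 1))
  pure fun _ _ => []

open Classical in
/-- Put a data point into its bucket, for each of the `G` hash functions: one evaluation of the
hash function and one dictionary operation. -/
def Tables.insert (s : DrawSeed H) (x : Pt d) (T : Tables H) : Timed (Tables H) :=
  Timed.loop fun g => do
    Timed.tick ((H g).hashCost + 1)
    let key := (H g).dataHash (s g).1 x
    pure (Function.update (T g) key (x :: T g key))

open Classical in
/-- Remove a data point from its bucket, for each of the `G` hash functions. -/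
def Tables.delete (s : DrawSeed H) (x : Pt d) (T : Tables H) : Timed (Tables H) :=
  Timed.loop fun g => do
    Timed.tick ((H g).hashCost + 1)
    let key := (H g).dataHash (s g).1 x
    pure (Function.update (T g) key ((T g key).erase x))

/-- One evaluation of the multi-resolution hashing-based estimator
`(1 / |X|) ∑ g, (w̃_g (q, y_g) * w (q, y_g) / p_g (q, y_g)) * |H_g (q)|`, where `y_g` is a
uniformly random element of the bucket `H_g (q)` of the query; empty buckets contribute `0`.
For every scheme the hash function is evaluated at the query, the bucket is looked up, one of its
elements is picked, and the target and all the collision probabilities are evaluated there. -/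
def estimate (t : Target d) (s : DrawSeed H) (T : Tables H) (size : ℕ) (q : Pt d) : Timed ℝ := do
  let terms ← Timed.loop fun g => do
    Timed.tick ((H g).hashCost + 2)
    let bucket := T g ((H g).queryHash (s g).1 q)
    match bucket[⌊((s g).2 : ℝ) * bucket.length⌋₊]? with
    | none => pure 0
    | some y => do
      Timed.tick (t.evalCost + ∑ i, (H i).probCost + (2 * G + 4))
      pure (hashWeight H g q y * t.w q y / (H g).collisionProb q y * bucket.length)
  Timed.tick (G + 1)
  pure ((∑ g, terms g) / size)

open Classical in
/-- The tables that contain the data set `X`: every bucket lists the points of `X` in it. -/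
def tablesOf (s : DrawSeed H) (X : List (Pt d)) : Tables H :=
  fun g key => X.filter fun x => (H g).dataHash (s g).1 x = key

/-- The multi-resolution estimator for the data set `X` at the query `q`, as a random variable. -/
def estimator (t : Target d) (X : List (Pt d)) (q : Pt d) (s : DrawSeed H) : ℝ :=
  (estimate t s (tablesOf s X) X.length q).val

/-- The pairwise summation `μ = (1 / |X|) ∑ x ∈ X, w (q, x)`. -/
def pairwiseMean (t : Target d) (X : List (Pt d)) (q : Pt d) : ℝ :=
  (X.map fun x => t.w q x).sum / X.length

variable (H) in
/-- The estimator is `V`-bounded (for data on the unit sphere and queries in the unit ball): it is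
unbiased, its relative variance is at most `V μ`, and `V μ` increases and `μ² V μ` decreases as
`μ` decreases to `0`. -/
structure VBounded (t : Target d) (V : ℝ → ℝ) : Prop where
  nonneg : ∀ μ, 0 ≤ V μ
  antitone : AntitoneOn V (Set.Ioc 0 1)
  monotone : MonotoneOn (fun μ => μ ^ 2 * V μ) (Set.Ioc 0 1)
  unbiased : ∀ X : List (Pt d), X ≠ [] → (∀ x ∈ X, ‖x‖ = 1) → ∀ q : Pt d, ‖q‖ ≤ 1 →
    ∫ s, estimator (H := H) t X q s ∂drawLaw H = pairwiseMean t X q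
  variance_le : ∀ X : List (Pt d), X ≠ [] → (∀ x ∈ X, ‖x‖ = 1) → ∀ q : Pt d, ‖q‖ ≤ 1 →
    ProbabilityTheory.variance (estimator (H := H) t X q) (drawLaw H) ≤
      pairwiseMean t X q ^ 2 * V (pairwiseMean t X q)

variable (H) in
/-- The estimator has complexity `C`: one draw of its hash functions, one update of its tables and
one evaluation take at most `C` steps each. -/
structure HasComplexity (t : Target d) (C : ℝ) : Prop where
  draw : ((Tables.empty (H := H)).cost : ℝ) ≤ C
  insert : ∀ (s : DrawSeed H) (x : Pt d) (T : Tables H), ((T.insert s x).cost : ℝ) ≤ C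
  delete : ∀ (s : DrawSeed H) (x : Pt d) (T : Tables H), ((T.delete s x).cost : ℝ) ≤ C
  evaluate : ∀ (s : DrawSeed H) (T : Tables H) (size : ℕ) (q : Pt d),
    ((estimate t s T size q).cost : ℝ) ≤ C

end Estimator

/-! ### The dynamic multi-resolution HBE -/

section HBE

variable {d G : ℕ}

/-- A dynamic multi-resolution HBE: the data points, and `B * m` independent multi-resolution
estimators, in `B` groups of `m`, with their seeds and their hash tables. -/
structure HBE (H : Fin G → HashScheme d) (B m : ℕ) where
  points : List (Pt d)
  seed : Fin B → Fin m → DrawSeed H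
  table : Fin B → Fin m → Tables H

variable {H : Fin G → HashScheme d} {B m : ℕ}

def HBE.insert (x : Pt d) (D : HBE H B m) : Timed (HBE H B m) := do
  let T ← Timed.loop fun i => Timed.loop fun j => Tables.insert (D.seed i j) x (D.table i j)
  Timed.tick 1
  pure ⟨x :: D.points, D.seed, T⟩

open Classical in
def HBE.delete (x : Pt d) (D : HBE H B m) : Timed (HBE H B m) := do
  let T ← Timed.loop fun i => Timed.loop fun j => Tables.delete (D.seed i j) x (D.table i j)
  Timed.tick 1
  pure ⟨D.points.erase x, D.seed, T⟩

/-- Draw the hash functions, then put the data points into the tables one by one. -/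
def HBE.init (ω : Fin B → Fin m → DrawSeed H) : List (Pt d) → Timed (HBE H B m)
  | [] => do
    let T ← Timed.loop fun _ => Timed.loop fun _ => Tables.empty
    pure ⟨[], ω, T⟩
  | x :: X => do
    let D ← HBE.init ω X
    D.insert x

/-- The median of the `B` means of `m` estimates each, or `0` if this is below the cutoff `θ`.
The median of `B` numbers is found by linear-time selection. -/
def HBE.query (t : Target d) (θ : ℝ) (D : HBE H B m) (q : Pt d) : Timed ℝ := do
  let Z ← Timed.loop fun i => Timed.loop fun j =>
    estimate t (D.seed i j) (D.table i j) D.points.length q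
  Timed.tick (B * m)
  let mean : Fin B → ℝ := fun i => (∑ j, Z i j) / m
  Timed.tick (B + 1)
  let z := median mean
  pure (if θ ≤ z then z else 0)

end HBE

/-! ### Nets of the unit ball -/

/-- A set of net points with a map that sends a query to a net point, and the time for finding
this net point. -/
structure Net (d : ℕ) where
  points : Set (Pt d)
  locate : Pt d → Pt d
  searchCost : ℕ

/-- `N` is an `ε₀`-net of the unit ball with at most `(10 / ε₀)^d` points, in which a net point at
distance at most `ε₀` is assigned to every query (for instance, a nearest net point). -/
structure Net.IsNet {d : ℕ} (N : Net d) (ε₀ : ℝ) : Prop where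
  finite : N.points.Finite
  card_le : (N.points.ncard : ℝ) ≤ (10 / ε₀) ^ d
  norm_le : ∀ p ∈ N.points, ‖p‖ ≤ 1
  locate_mem : ∀ q, ‖q‖ ≤ 1 → N.locate q ∈ N.points
  dist_locate_le : ∀ q, ‖q‖ ≤ 1 → dist q (N.locate q) ≤ ε₀

/-- Round every coordinate towards zero to a multiple of `ε₀ / √d`. -/
def gridPoint {d : ℕ} (ε₀ : ℝ) (q : Pt d) : Pt d :=
  WithLp.toLp 2 fun i =>
    let a := ε₀ / √(d : ℝ)
    a * ((if 0 ≤ q i then ⌊q i / a⌋ else ⌈q i / a⌉ : ℤ) : ℝ)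

/-- The cubic grid; a query is located by rounding its `d` coordinates. -/
def gridNet (d : ℕ) (ε₀ : ℝ) : Net d where
  points := gridPoint ε₀ '' {q | ‖q‖ ≤ 1}
  locate := gridPoint ε₀
  searchCost := d

/-! ### Adam-Hash -/

section AdamHash

variable {d G : ℕ}

/-- Adam-Hash keeps `L` multi-resolution HBEs. -/
abbrev AdamHash (H : Fin G → HashScheme d) (L B m : ℕ) : Type := Fin L → HBE H B m

/-- All the random choices of the data structure are made at initialization. -/
abbrev Coins (H : Fin G → HashScheme d) (L B m : ℕ) : Type :=
  Fin L → Fin B → Fin m → DrawSeed H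

/-- All the `L * B * m` estimators are drawn independently. -/
def coinLaw (H : Fin G → HashScheme d) (L B m : ℕ) : Measure (Coins H L B m) :=
  Measure.pi fun _ => Measure.pi fun _ => Measure.pi fun _ => drawLaw H

variable {H : Fin G → HashScheme d} {L B m : ℕ}

def AdamHash.init (ω : Coins H L B m) (X : List (Pt d)) : Timed (AdamHash H L B m) :=
  Timed.loop fun j => HBE.init (ω j) X

def AdamHash.insert (x : Pt d) (A : AdamHash H L B m) : Timed (AdamHash H L B m) :=
  Timed.loop fun j => (A j).insert x

def AdamHash.delete (x : Pt d) (A : AdamHash H L B m) : Timed (AdamHash H L B m) :=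
  Timed.loop fun j => (A j).delete x

/-- Move the query to the net, query the `L` HBEs there, and return the median of the answers. -/
def AdamHash.query (t : Target d) (N : Net d) (θ : ℝ) (A : AdamHash H L B m) (q : Pt d) :
    Timed ℝ := do
  Timed.tick N.searchCost
  let p := N.locate q
  let y ← Timed.loop fun j => (A j).query t θ p
  Timed.tick L
  pure (median y)

/-- An update of the data set. -/
inductive Update (d : ℕ) where
  | insert (x : Pt d)
  | delete (x : Pt d)

def Update.point : Update d → Pt d
  | .insert x => x
  | .delete x => x

open Classical in
/-- The effect of an update on the data set (a list, repetitions are allowed). -/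
def Update.onData (X : List (Pt d)) : Update d → List (Pt d)
  | .insert x => x :: X
  | .delete x => X.erase x

def Update.onState (A : AdamHash H L B m) : Update d → AdamHash H L B m
  | .insert x => (A.insert x).val
  | .delete x => (A.delete x).val

/-- The data set after a sequence of updates. -/
def dataAfter (X : List (Pt d)) (us : List (Update d)) : List (Pt d) :=
  us.foldl Update.onData X

/-- The data structure after initialization with coins `ω` and a sequence of updates. -/
def stateAfter (ω : Coins H L B m) (X : List (Pt d)) (us : List (Update d)) : AdamHash H L B m :=
  us.foldl Update.onState (AdamHash.init ω X).val

end AdamHash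

/-! ### Correctness -/

/-- The answer `z` is correct for the value `μ`: a `(1 ± ε)`-approximation of `μ`, or else `0`,
the latter only if `μ < τ`, and always if `μ < (1 - ε) τ`. -/
def IsCorrect (ε τ μ z : ℝ) : Prop :=
  (τ ≤ μ → |z - μ| ≤ ε * μ) ∧ (μ < τ → z = 0 ∨ |z - μ| ≤ ε * μ) ∧ (μ < (1 - ε) * τ → z = 0)

/-- The answers to the first `i` queries of an adversary, who chooses each query as a function of
the list of the answers to all the previous ones. -/
def adaptiveAnswers {d : ℕ} (answer : Pt d → ℝ) (adversary : List ℝ → Pt d) : ℕ → List ℝ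
  | 0 => []
  | i + 1 =>
    adaptiveAnswers answer adversary i ++ [answer (adversary (adaptiveAnswers answer adversary i))]

end

/-! For fixed coins, the state after any updates depends only on the coins and the current data, and
the answer depends on `q` only through its net point. Hence it suffices to control finitely many
points. At a net point with mean `ν`, `V`-boundedness bounds the variance by `max ν τ ^ 2 * V τ`
(`VBounded.variance_le_max`), so one accuracy `ε / 16 * max ν τ` serves both above and below the
threshold. Chebyshev makes the mean of one group wrong with probability at most `2⁻¹⁴`; the inner
median brings this to `2⁻⁶`, and the outer median over `L` HBEs to `4⁻ᴸ` (`measure_median_sub_le`).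
With `L` of order `Λ` this beats the `(10 / ε₀) ^ d` terms of the union bound over the net.

The cutoff is monotone, so it commutes with the outer median and needs to be considered only once,
at the end. The Lipschitz condition with `k * ε₀ = ε * τ / 16` carries the estimate from the net
point back to `q` (`isCorrect_cutoff`). The resulting event covers all queries in the ball
simultaneously, hence also adaptively chosen ones.

All probability bounds use only monotonicity and subadditivity on arbitrary sets for the failure
events, so their measurability never matters. Running times are sums over the nested loops, with
overheads absorbed by `1 ≤ C`. -/

/-! ### Medians -/

/-- A permutation sorting `v` also sorts `f ∘ v`, and the sorted sequence does not depend on the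
sorting permutation. Applied to `cutoff`, this reduces the median of truncated answers to one
truncated median. -/
theorem median_comp {n : ℕ} (hn : 0 < n) {f : ℝ → ℝ} (hf : Monotone f) (v : Fin n → ℝ) :
    median (f ∘ v) = f (median v) := by
  have h := Tuple.unique_monotone (f := f ∘ v) (σ := Tuple.sort (f ∘ v)) (τ := Tuple.sort v)
    (Tuple.monotone_sort _) (hf.comp (Tuple.monotone_sort v))
  simp only [median, hn, dif_pos]
  exact congrFun h _

/-- If more than half of the numbers lie in an interval, then so does their median. -/
theorem median_mem_Icc {n : ℕ} {v : Fin n → ℝ} {a b : ℝ}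
    (h : 2 * (Finset.univ.filter fun i => v i ∉ Set.Icc a b).card < n) :
    median v ∈ Set.Icc a b := by
  have hn : 0 < n := by omega
  have hsort := Tuple.monotone_sort v
  set k : Fin n := ⟨n / 2, Nat.div_lt_self hn one_lt_two⟩ with hk
  -- Were the median outside, say below `a`, all sorted positions up to `n / 2` would be outside
  -- too. These are `n / 2 + 1` positions; those from `n / 2` on number `n - n / 2`. Either way this
  -- is at least half of all, against the hypothesis.
  have key : ∀ s : Finset (Fin n), (∀ i ∈ s, v (Tuple.sort v i) ∉ Set.Icc a b) →
      n ≤ 2 * s.card → False := by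
    intro s hs hcard
    have : (s.map (Tuple.sort v).toEmbedding).card ≤
        (Finset.univ.filter fun i => v i ∉ Set.Icc a b).card := by
      apply Finset.card_le_card
      intro i hi
      obtain ⟨j, hj, rfl⟩ := Finset.mem_map.1 hi
      simpa using hs j hj
    rw [Finset.card_map] at this
    omega
  have hmed : median v = v (Tuple.sort v k) := by simp only [median, hn, dif_pos, hk]
  rw [hmed]
  constructor
  · by_contra! hlt
    refine key (Finset.Iic k) (fun i hi => ?_) ?_
    · have : v (Tuple.sort v i) ≤ v (Tuple.sort v k) := hsort (Finset.mem_Iic.1 hi)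
      exact fun hmem => absurd hmem.1 (by linarith)
    · rw [Fin.card_Iic]; simp only [hk]; omega
  · by_contra! hlt
    refine key (Finset.Ici k) (fun i hi => ?_) ?_
    · have : v (Tuple.sort v k) ≤ v (Tuple.sort v i) := hsort (Finset.mem_Ici.1 hi)
      exact fun hmem => absurd hmem.2 (by linarith)
    · rw [Fin.card_Ici]; simp only [hk]; omega

/-! ### Amplification of the success probability -/

open scoped ENNReal

/-- Among `n` independent samples, at least half are bad with probability at most `(2 r)^n`, if
every single one is bad with probability at most `r²`. -/
theorem measure_pi_half_le {n : ℕ} {Ω : Type*} [MeasurableSpace Ω] (P : Measure Ω)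
    [IsProbabilityMeasure P] (bad : Set Ω) [DecidablePred (· ∈ bad)] {r : ℝ≥0∞} (hr : r ≤ 1) (h : P bad ≤ r ^ 2) :
    Measure.pi (fun _ : Fin n => P)
      {ω | n ≤ 2 * (Finset.univ.filter fun i => ω i ∈ bad).card} ≤ (2 * r) ^ n := by
  -- Union bound over the possible sets `S` of bad indices: at most `2 ^ n` sets, each contributing
  -- `(r ^ 2) ^ S.card ≤ r ^ n`. The product formula for boxes holds for arbitrary sets, so `bad`
  -- need not be measurable.
  let F : Finset (Finset (Fin n)) := Finset.univ.filter fun S => n ≤ 2 * S.card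
  have hsub : {ω : Fin n → Ω | n ≤ 2 * (Finset.univ.filter fun i => ω i ∈ bad).card} ⊆
      ⋃ S ∈ F, Set.pi Set.univ fun i => if i ∈ S then bad else Set.univ := by
    intro ω hω
    simp only [Set.mem_iUnion]
    refine ⟨Finset.univ.filter fun i => ω i ∈ bad, by simpa [F] using hω, fun i _ => ?_⟩
    by_cases hi : ω i ∈ bad <;> simp [hi]
  refine (measure_mono hsub).trans <| (measure_biUnion_finset_le _ _).trans ?_
  calc ∑ S ∈ F, Measure.pi (fun _ : Fin n => P)
        (Set.pi Set.univ fun i => if i ∈ S then bad else Set.univ)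
      ≤ ∑ S ∈ F, r ^ n := by
        refine Finset.sum_le_sum fun S hS => ?_
        rw [Measure.pi_pi]
        calc ∏ i, P (if i ∈ S then bad else Set.univ)
            ≤ ∏ i, (if i ∈ S then r ^ 2 else 1) := by
              refine Finset.prod_le_prod' fun i _ => ?_
              split_ifs
              · exact h
              · simp
          _ = r ^ (2 * S.card) := by
              rw [Finset.prod_ite_mem, Finset.univ_inter, Finset.prod_const, pow_mul]
          _ ≤ r ^ n := pow_le_pow_right_of_le_one' hr (by simpa [F] using hS)
    _ = F.card * r ^ n := by rw [Finset.sum_const, nsmul_eq_mul]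
    _ ≤ 2 ^ n * r ^ n := by
        gcongr
        have : F.card ≤ 2 ^ n := by
          simpa using Finset.card_le_univ F
        exact_mod_cast this
    _ = (2 * r) ^ n := (mul_pow _ _ _).symm

/-- Chebyshev's inequality for the mean of `m` independent samples. -/
theorem measure_pi_mean_sub_le {m : ℕ} (hm : 0 < m) {Ω : Type*} [MeasurableSpace Ω]
    (P : Measure Ω) [IsProbabilityMeasure P] {Z : Ω → ℝ} (hZ : MemLp Z 2 P) {v η : ℝ}
    (hv : ProbabilityTheory.variance Z P ≤ v) (hη : 0 < η) :
    Measure.pi (fun _ : Fin m => P) {ω | η < |(∑ j, Z (ω j)) / m - ∫ x, Z x ∂P|} ≤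
      ENNReal.ofReal (v / (m * η ^ 2)) := by
  have hm' : (0 : ℝ) < m := by exact_mod_cast hm
  set Q := Measure.pi fun _ : Fin m => P
  let Y : (Fin m → Ω) → ℝ := ∑ j, fun ω => Z (ω j)
  have hcoord : ∀ j : Fin m, MemLp (fun ω : Fin m → Ω => Z (ω j)) 2 Q := fun j =>
    hZ.comp_measurePreserving (measurePreserving_eval (fun _ : Fin m => P) j)
  have hY : MemLp Y 2 Q := memLp_finsetSum' _ fun j _ => hcoord j
  have hvar : ProbabilityTheory.variance Y Q ≤ m * v := by
    rw [show ProbabilityTheory.variance Y Q = _ from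
      ProbabilityTheory.variance_sum_pi (μ := fun _ : Fin m => P) (X := fun _ => Z) fun _ => hZ]
    simp only [Finset.sum_const, Finset.card_univ, Fintype.card_fin, nsmul_eq_mul]
    gcongr
  have hmean : ∫ ω, Y ω ∂Q = m * ∫ x, Z x ∂P := by
    simp only [Y, Finset.sum_apply]
    rw [integral_finsetSum _ fun j _ => (hcoord j).integrable (by norm_num)]
    have : ∀ j : Fin m, ∫ ω, Z (ω j) ∂Q = ∫ x, Z x ∂P := fun j =>
      integral_comp_eval (μ := fun _ : Fin m => P) (i := j) hZ.aestronglyMeasurable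
    simp [this]
  have hch := ProbabilityTheory.meas_ge_le_variance_div_sq hY (c := m * η) (by positivity)
  refine (measure_mono fun ω hω => ?_).trans (hch.trans (ENNReal.ofReal_le_ofReal ?_))
  · have hω' : η < |(∑ j, Z (ω j)) / m - ∫ x, Z x ∂P| := hω
    change m * η ≤ |Y ω - ∫ ω, Y ω ∂Q|
    have : Y ω - ∫ ω, Y ω ∂Q = m * ((∑ j, Z (ω j)) / m - ∫ x, Z x ∂P) := by
      rw [hmean]; simp only [Y, Finset.sum_apply]; field_simp
    rw [this, abs_mul, abs_of_pos hm']
    gcongr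
  · calc ProbabilityTheory.variance Y Q / (m * η) ^ 2 ≤ m * v / (m * η) ^ 2 := by gcongr
      _ = v / (m * η ^ 2) := by field_simp

/-! ### The cubic grid -/

theorem abs_roundTowardZero_sub_le (y : ℝ) : |y - ((if 0 ≤ y then ⌊y⌋ else ⌈y⌉ : ℤ) : ℝ)| ≤ 1 := by
  split_ifs
  · rw [abs_le]; constructor <;> linarith [Int.floor_le y, Int.lt_floor_add_one y]
  · rw [abs_le]; constructor <;> linarith [Int.le_ceil y, Int.ceil_lt_add_one y]

theorem abs_roundTowardZero_le (y : ℝ) : |((if 0 ≤ y then ⌊y⌋ else ⌈y⌉ : ℤ) : ℝ)| ≤ |y| := by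
  split_ifs with h
  · have : (0 : ℝ) ≤ ⌊y⌋ := by exact_mod_cast Int.floor_nonneg.2 h
    rw [abs_of_nonneg this, abs_of_nonneg h]; exact Int.floor_le y
  · have h' : y ≤ 0 := by linarith
    have : (⌈y⌉ : ℝ) ≤ 0 := by exact_mod_cast Int.ceil_le.2 (by simpa using h')
    rw [abs_of_nonpos this, abs_of_nonpos h']; linarith [Int.le_ceil y]

theorem gridPoint_apply {d : ℕ} {ε₀ : ℝ} (ha : 0 < ε₀ / √(d : ℝ)) (q : Pt d) (i : Fin d) :
    gridPoint ε₀ q i = ε₀ / √(d : ℝ) *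
      ((if 0 ≤ q i / (ε₀ / √(d : ℝ)) then ⌊q i / (ε₀ / √(d : ℝ))⌋
        else ⌈q i / (ε₀ / √(d : ℝ))⌉ : ℤ) : ℝ) := by
  have : 0 ≤ q i / (ε₀ / √(d : ℝ)) ↔ 0 ≤ q i := by
    rw [le_div_iff₀ ha, zero_mul]
  simp only [this]
  rfl

theorem abs_gridPoint_le {d : ℕ} {ε₀ : ℝ} (ha : 0 < ε₀ / √(d : ℝ)) (q : Pt d) (i : Fin d) :
    |gridPoint ε₀ q i| ≤ |q i| := by
  rw [gridPoint_apply ha, abs_mul, abs_of_pos ha]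
  calc _ ≤ ε₀ / √(d : ℝ) * |q i / (ε₀ / √(d : ℝ))| := by
        exact mul_le_mul_of_nonneg_left (abs_roundTowardZero_le _) ha.le
    _ = |q i| := by rw [abs_div, abs_of_pos ha, mul_div_cancel₀ _ ha.ne']

theorem abs_sub_gridPoint_le {d : ℕ} {ε₀ : ℝ} (ha : 0 < ε₀ / √(d : ℝ)) (q : Pt d) (i : Fin d) :
    |q i - gridPoint ε₀ q i| ≤ ε₀ / √(d : ℝ) := by
  have h := abs_roundTowardZero_sub_le (q i / (ε₀ / √(d : ℝ)))
  set a := ε₀ / √(d : ℝ) with ha'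
  rw [gridPoint_apply ha, ← ha']
  calc _ = |a * (q i / a - ((if 0 ≤ q i / a then ⌊q i / a⌋ else ⌈q i / a⌉ : ℤ) : ℝ))| := by
        congr 1; rw [mul_sub, mul_div_cancel₀ _ ha.ne']
    _ = a * _ := by rw [abs_mul, abs_of_pos ha]
    _ ≤ a * 1 := by gcongr
    _ = a := mul_one a

theorem sum_Icc_pow_natAbs_le {x : ℝ} (hx0 : 0 < x) (hx1 : x < 1) (M : ℕ) :
    ∑ n ∈ Finset.Icc (-(M : ℤ)) M, x ^ n.natAbs ≤ 1 + 2 * (x / (1 - x)) := by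
  have hgeom : ∀ M : ℕ, ∑ i ∈ Finset.range M, x ^ (i + 1) ≤ x / (1 - x) := by
    intro M
    have h1 : ∑ i ∈ Finset.range M, x ^ i ≤ (1 - x)⁻¹ := by
      rw [← tsum_geometric_of_lt_one hx0.le hx1]
      exact (summable_geometric_of_lt_one hx0.le hx1).sum_le_tsum _ fun _ _ => by positivity
    simp only [pow_succ, ← Finset.sum_mul]
    rw [div_eq_inv_mul]
    gcongr
  have hsum : ∑ n ∈ Finset.Icc (-(M : ℤ)) M, x ^ n.natAbs =
      1 + 2 * ∑ i ∈ Finset.range M, x ^ (i + 1) := by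
    induction M with
    | zero => simp
    | succ M ih =>
      have : Finset.Icc (-((M + 1 : ℕ) : ℤ)) ((M + 1 : ℕ) : ℤ) =
          insert (-((M + 1 : ℕ) : ℤ)) (insert ((M + 1 : ℕ) : ℤ) (Finset.Icc (-(M : ℤ)) M)) := by
        ext n; simp only [Finset.mem_Icc, Finset.mem_insert]; omega
      rw [this, Finset.sum_insert, Finset.sum_insert, ih, Finset.sum_range_succ, Int.natAbs_neg,
        Int.natAbs_natCast]
      · ring
      · simp
      · simp only [Finset.mem_insert, Finset.mem_Icc, not_or]; omega
  rw [hsum]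
  linarith [hgeom M]

/-- The number of integer points of `ℓ¹`-norm at most `d y` in dimension `d`. -/
theorem ncard_int_sum_natAbs_le (d : ℕ) {y : ℝ} (hy : 0 < y) :
    {n : Fin d → ℤ | ∑ i, ((n i).natAbs : ℝ) ≤ d * y}.Finite ∧
    ({n : Fin d → ℤ | ∑ i, ((n i).natAbs : ℝ) ≤ d * y}.ncard : ℝ) ≤
      (Real.exp 1 * (1 + 2 * y)) ^ d := by
  classical
  set M : ℕ := ⌈d * y⌉₊
  let F : Finset (Fin d → ℤ) := Fintype.piFinset fun _ => Finset.Icc (-(M : ℤ)) M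
  have hset : {n : Fin d → ℤ | ∑ i, ((n i).natAbs : ℝ) ≤ d * y} =
      (F.filter fun n => ∑ i, ((n i).natAbs : ℝ) ≤ d * y : Finset _) := by
    ext n
    simp only [Set.mem_ofPred_eq, Finset.coe_filter, iff_and_self, F, Fintype.mem_piFinset]
    intro h i
    have h1 : ((n i).natAbs : ℝ) ≤ d * y :=
      (Finset.single_le_sum (f := fun i => ((n i).natAbs : ℝ)) (fun _ _ => by positivity)
        (Finset.mem_univ i)).trans h
    have h2 : (n i).natAbs ≤ M := by exact_mod_cast h1.trans (Nat.le_ceil _)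
    rw [Finset.mem_Icc]; omega
  rw [hset]
  refine ⟨Finset.finite_toSet _, ?_⟩
  rw [Set.ncard_coe_finset]
  -- Exponential weights: give `n` the weight `exp d * ∏ x ^ |n i|`, which is at least `1` on the
  -- points to be counted. The total weight factorizes into `d` two-sided geometric sums, and `exp
  -- (1 / y) ≥ 1 + 1 / y` bounds each by `1 + 2 * y`.
  set x : ℝ := Real.exp (-(1 / y)) with hx
  have hx0 : 0 < x := Real.exp_pos _
  have hx1 : x < 1 := by rw [hx, Real.exp_lt_one_iff]; simpa using hy
  have hxy : x / (1 - x) ≤ y := by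
    have h1 : 1 / y + 1 ≤ Real.exp (1 / y) := Real.add_one_le_exp _
    have h2 : x * Real.exp (1 / y) = 1 := by rw [hx, ← Real.exp_add]; simp
    rw [div_le_iff₀ (by linarith)]
    have h3 : x * (1 / y + 1) ≤ 1 := by
      calc x * (1 / y + 1) ≤ x * Real.exp (1 / y) := by gcongr
        _ = 1 := h2
    have h4 : x * (1 / y + 1) * y ≤ 1 * y := by gcongr
    have h5 : x * (1 / y + 1) * y = x + x * y := by field_simp
    linarith
  have hterm : ∀ n ∈ F.filter fun n => ∑ i, ((n i).natAbs : ℝ) ≤ d * y,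
      (1 : ℝ) ≤ Real.exp d * ∏ i, x ^ (n i).natAbs := by
    intro n hn
    have h := (Finset.mem_filter.1 hn).2
    have : ∏ i, x ^ (n i).natAbs = Real.exp (-(∑ i, ((n i).natAbs : ℝ)) / y) := by
      simp only [hx, ← Real.exp_nat_mul, ← Real.exp_sum]
      congr 1
      rw [neg_div, Finset.sum_div, ← Finset.sum_neg_distrib]
      exact Finset.sum_congr rfl fun i _ => by ring
    rw [this, ← Real.exp_add]
    apply Real.one_le_exp
    have : (∑ i, ((n i).natAbs : ℝ)) / y ≤ d := by rwa [div_le_iff₀ hy]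
    rw [neg_div]; linarith
  calc ((F.filter fun n => ∑ i, ((n i).natAbs : ℝ) ≤ d * y).card : ℝ)
      = ∑ n ∈ F.filter fun n => ∑ i, ((n i).natAbs : ℝ) ≤ d * y, 1 := by simp
    _ ≤ ∑ n ∈ F.filter fun n => ∑ i, ((n i).natAbs : ℝ) ≤ d * y,
          Real.exp d * ∏ i, x ^ (n i).natAbs := Finset.sum_le_sum hterm
    _ ≤ ∑ n ∈ F, Real.exp d * ∏ i, x ^ (n i).natAbs :=
        Finset.sum_le_sum_of_subset_of_nonneg (Finset.filter_subset _ _)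
          fun _ _ _ => by positivity
    _ = Real.exp d * (∑ n ∈ Finset.Icc (-(M : ℤ)) M, x ^ n.natAbs) ^ d := by
        rw [← Finset.mul_sum, ← Finset.prod_univ_sum (fun _ : Fin d => Finset.Icc (-(M : ℤ)) M)
          fun _ n => x ^ n.natAbs]
        simp
    _ ≤ Real.exp d * (1 + 2 * y) ^ d := by
        gcongr
        exact (sum_Icc_pow_natAbs_le hx0 hx1 M).trans (by linarith)
    _ = (Real.exp 1 * (1 + 2 * y)) ^ d := by
        rw [mul_pow, ← Real.exp_nat_mul, mul_one]

/-- Rounding towards zero shrinks every coordinate, so grid points stay in the ball, and their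
integer coordinates have `ℓ¹`-norm at most `√d / a = d / ε₀` by Cauchy–Schwarz. Counting such
integer points gives `(e * (1 + 2 / ε₀)) ^ d`, and `e * (ε₀ + 2) ≤ 3 * e < 10`. -/
theorem gridNet_isNet {d : ℕ} (hd : 0 < d) {ε₀ : ℝ} (h0 : 0 < ε₀) (h1 : ε₀ ≤ 1) :
    (gridNet d ε₀).IsNet ε₀ := by
  have hd' : (0 : ℝ) < d := by exact_mod_cast hd
  have hsqrt : 0 < √(d : ℝ) := Real.sqrt_pos.2 hd'
  have ha : 0 < ε₀ / √(d : ℝ) := by positivity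
  set a := ε₀ / √(d : ℝ) with ha'
  have hnorm : ∀ q : Pt d, ‖gridPoint ε₀ q‖ ≤ ‖q‖ := fun q => by
    rw [EuclideanSpace.norm_eq, EuclideanSpace.norm_eq]
    refine Real.sqrt_le_sqrt (Finset.sum_le_sum fun i _ => ?_)
    rw [Real.norm_eq_abs, Real.norm_eq_abs]
    exact pow_le_pow_left₀ (abs_nonneg _) (abs_gridPoint_le ha q i) 2
  let S := {n : Fin d → ℤ | ∑ i, ((n i).natAbs : ℝ) ≤ d * (1 / ε₀)}
  obtain ⟨hfin, hcard⟩ := ncard_int_sum_natAbs_le d (y := 1 / ε₀) (by positivity)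
  have hsub : (gridNet d ε₀).points ⊆
      (fun n : Fin d → ℤ => (WithLp.toLp 2 fun i => a * (n i : ℝ) : Pt d)) '' S := by
    rintro _ ⟨q, hq, rfl⟩
    let n : Fin d → ℤ := fun i => if 0 ≤ q i / a then ⌊q i / a⌋ else ⌈q i / a⌉
    refine ⟨n, ?_, ?_⟩
    · change ∑ i, ((n i).natAbs : ℝ) ≤ d * (1 / ε₀)
      have hn : ∀ i, ((n i).natAbs : ℝ) ≤ |q i| / a := fun i => by
        have := abs_roundTowardZero_le (q i / a)
        rw [abs_div, abs_of_pos ha] at this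
        rw [Nat.cast_natAbs, Int.cast_abs]
        exact this
      have hl1 : ∑ i, |q i| ≤ √(d : ℝ) := by
        have hcs := sq_sum_le_card_mul_sum_sq (s := Finset.univ) (f := fun i => |q i|)
        have hq2 : ∑ i, |q i| ^ 2 ≤ 1 := by
          have : ‖q‖ ^ 2 ≤ 1 := pow_le_one₀ (norm_nonneg q) hq
          rw [EuclideanSpace.norm_sq_eq] at this
          simpa using this
        apply Real.le_sqrt_of_sq_le
        rw [Finset.card_univ, Fintype.card_fin] at hcs
        nlinarith
      calc ∑ i, ((n i).natAbs : ℝ) ≤ ∑ i, |q i| / a := Finset.sum_le_sum fun i _ => hn i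
        _ = (∑ i, |q i|) / a := by rw [Finset.sum_div]
        _ ≤ √(d : ℝ) / a := by gcongr
        _ = (√(d : ℝ) * √(d : ℝ)) * (1 / ε₀) := by rw [ha']; field_simp
        _ = d * (1 / ε₀) := by rw [Real.mul_self_sqrt hd'.le]
    · ext i
      exact (gridPoint_apply ha q i).symm
  refine ⟨(hfin.image _).subset hsub, ?_, ?_, fun q hq => ⟨q, hq, rfl⟩, fun q _ => ?_⟩
  · calc ((gridNet d ε₀).points.ncard : ℝ) ≤ S.ncard := by
          exact_mod_cast (Set.ncard_le_ncard hsub (hfin.image _)).trans (Set.ncard_image_le hfin)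
      _ ≤ (Real.exp 1 * (1 + 2 * (1 / ε₀))) ^ d := hcard
      _ ≤ (10 / ε₀) ^ d := by
          gcongr
          rw [le_div_iff₀ h0]
          have : Real.exp 1 * (1 + 2 * (1 / ε₀)) * ε₀ = Real.exp 1 * (ε₀ + 2) := by field_simp
          rw [this]
          nlinarith [Real.exp_one_lt_d9, Real.exp_pos 1]
  · rintro _ ⟨q, hq, rfl⟩
    exact (hnorm q).trans hq
  · change dist q (gridPoint ε₀ q) ≤ ε₀
    rw [EuclideanSpace.dist_eq]
    apply Real.sqrt_le_iff.2 ⟨h0.le, ?_⟩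
    calc ∑ i, dist (q i) (gridPoint ε₀ q i) ^ 2 ≤ ∑ _i : Fin d, a ^ 2 := by
          refine Finset.sum_le_sum fun i _ => ?_
          rw [Real.dist_eq]
          gcongr
          exact abs_sub_gridPoint_le ha q i
      _ = ε₀ ^ 2 := by
          simp only [Finset.sum_const, Finset.card_univ, Fintype.card_fin, nsmul_eq_mul]
          rw [ha', div_pow, Real.sq_sqrt hd'.le]; field_simp

/-! ### The state of the data structure -/

section State

variable {d G : ℕ} {H : Fin G → HashScheme d} {L B m : ℕ}

theorem insert_tablesOf (s : DrawSeed H) (x : Pt d) (X : List (Pt d)) :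
    ((tablesOf s X).insert s x).val = tablesOf s (x :: X) := by
  classical
  funext g key
  change Function.update (tablesOf s X g) _ _ key = _
  by_cases h : (H g).dataHash (s g).1 x = key
  · subst h; simp [tablesOf]
  · rw [Function.update_of_ne (Ne.symm h)]; simp [tablesOf, h]

/-- Erasing one occurrence commutes with filtering into buckets; for an absent point both sides are
unchanged. -/
theorem delete_tablesOf (s : DrawSeed H) (x : Pt d) (X : List (Pt d)) :
    ((tablesOf s X).delete s x).val = tablesOf s ((Update.delete x).onData X) := by
  classical
  funext g key
  change Function.update (tablesOf s X g) _ _ key =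
    (X.erase x).filter fun x => (H g).dataHash (s g).1 x = key
  rw [← List.erase_filter]
  by_cases h : (H g).dataHash (s g).1 x = key
  · subst h; simp [tablesOf]
  · rw [Function.update_of_ne (Ne.symm h), List.erase_of_not_mem (by simp [h])]
    rfl

/-- The HBE with seeds `ω` whose tables contain the data set `X`. -/
noncomputable def HBE.ofData (ω : Fin B → Fin m → DrawSeed H) (X : List (Pt d)) : HBE H B m :=
  ⟨X, ω, fun i j => tablesOf (ω i j) X⟩

theorem HBE.insert_ofData (ω : Fin B → Fin m → DrawSeed H) (x : Pt d) (X : List (Pt d)) :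
    ((HBE.ofData ω X).insert x).val = HBE.ofData ω (x :: X) := by
  have : ((HBE.ofData ω X).insert x).val =
    ⟨x :: X, ω, fun i j => ((tablesOf (ω i j) X).insert (ω i j) x).val⟩ := rfl
  rw [this]
  simp only [insert_tablesOf, HBE.ofData]

theorem HBE.delete_ofData (ω : Fin B → Fin m → DrawSeed H) (x : Pt d) (X : List (Pt d)) :
    ((HBE.ofData ω X).delete x).val = HBE.ofData ω ((Update.delete x).onData X) := by
  have : ((HBE.ofData ω X).delete x).val =
    ⟨(Update.delete x).onData X, ω,
      fun i j => ((tablesOf (ω i j) X).delete (ω i j) x).val⟩ := rfl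
  rw [this]
  simp only [delete_tablesOf, HBE.ofData]

theorem HBE.init_val (ω : Fin B → Fin m → DrawSeed H) (X : List (Pt d)) :
    (HBE.init ω X).val = HBE.ofData ω X := by
  induction X with
  | nil => rfl
  | cons x X ih =>
    change ((HBE.init ω X).val.insert x).val = _
    rw [ih, HBE.insert_ofData]

/-- History independence: the tables look as if freshly built from the current data. Since the
updates are fixed before the coins are drawn, the estimators keep their product law. -/
theorem stateAfter_eq (ω : Coins H L B m) (X : List (Pt d)) (us : List (Update d)) :
    stateAfter ω X us = fun j => HBE.ofData (ω j) (dataAfter X us) := by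
  have key : ∀ X : List (Pt d), us.foldl Update.onState
      (fun j => HBE.ofData (ω j) X : AdamHash H L B m) =
      fun j => HBE.ofData (ω j) (us.foldl Update.onData X) := by
    induction us with
    | nil => intro X; rfl
    | cons u us ih =>
      intro X
      rw [List.foldl_cons, List.foldl_cons, ← ih]
      congr 1
      funext j
      cases u with
      | insert x => exact HBE.insert_ofData _ _ _
      | delete x => exact HBE.delete_ofData _ _ _
  rw [stateAfter, dataAfter, ← key]
  congr 1
  funext j
  exact HBE.init_val _ _

theorem norm_eq_one_of_mem_dataAfter {X : List (Pt d)} {us : List (Update d)}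
    (hX : ∀ x ∈ X, ‖x‖ = 1) (hus : ∀ u ∈ us, ‖u.point‖ = 1) :
    ∀ x ∈ dataAfter X us, ‖x‖ = 1 := by
  induction us generalizing X with
  | nil => exact hX
  | cons u us ih =>
    refine ih (X := u.onData X) ?_ fun u hu => hus u (List.mem_cons_of_mem _ hu)
    have hu := hus u List.mem_cons_self
    cases u with
    | insert y => exact List.forall_mem_cons.2 ⟨hu, hX⟩
    | delete y => exact fun x hx => hX x (List.mem_of_mem_erase hx)

/-- Values below the cutoff `θ` are replaced by `0`. -/
noncomputable def cutoff (θ z : ℝ) : ℝ := if θ ≤ z then z else 0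

theorem cutoff_monotone {θ : ℝ} (hθ : 0 ≤ θ) : Monotone (cutoff θ) := by
  intro a b hab
  unfold cutoff
  split_ifs <;> linarith

theorem query_stateAfter (t : Target d) (N : Net d) (θ : ℝ) (ω : Coins H L B m)
    (X : List (Pt d)) (us : List (Update d)) (q : Pt d) :
    (AdamHash.query t N θ (stateAfter ω X us) q).val =
      median (cutoff θ ∘ fun j => median fun i =>
        (∑ l, estimator t (dataAfter X us) (N.locate q) (ω j i l)) / m) := by
  rw [stateAfter_eq]
  rfl

end State

/-! ### Step counts -/

section Cost

variable {d G : ℕ} {H : Fin G → HashScheme d} {t : Target d} {C : ℝ} {L B m : ℕ}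

/-- Even on empty tables an evaluation pays its final `G + 1` steps. A seed exists because a
probability space is nonempty. -/
theorem HasComplexity.one_le (h : HasComplexity H t C) : 1 ≤ C := by
  have s : DrawSeed H := fun g => ⟨(nonempty_of_isProbabilityMeasure (H g).law).some, 0⟩
  refine le_trans ?_ (h.evaluate s (fun _ _ => []) 0 0)
  have : 1 ≤ (estimate t s (fun _ _ => []) 0 0).cost :=
    le_trans (by omega : 1 ≤ G + 1 + 0) (Nat.le_add_left _ _)
  exact_mod_cast this

theorem cost_loop_le {ι : Type} [Fintype ι] {β : ι → Type} {f : ∀ i, Timed (β i)} {b : ℝ}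
    (h : ∀ i, ((f i).cost : ℝ) ≤ b) : ((Timed.loop f).cost : ℝ) ≤ Fintype.card ι * b := by
  change ((∑ i, (f i).cost : ℕ) : ℝ) ≤ _
  push_cast
  exact (Finset.sum_le_sum fun i _ => h i).trans (by simp)

theorem cost_loop_loop_le {α : Type} {f : Fin B → Fin m → Timed α} {b : ℝ}
    (h : ∀ i j, ((f i j).cost : ℝ) ≤ b) :
    ((Timed.loop fun i => Timed.loop fun j => f i j).cost : ℝ) ≤ B * (m * b) := by
  have := cost_loop_le fun i => cost_loop_le fun j => h i j
  simpa using this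

theorem HBE.cost_insert_le (h : HasComplexity H t C) (x : Pt d) (D : HBE H B m) :
    ((D.insert x).cost : ℝ) ≤ B * (m * C) + 1 := by
  have e : (D.insert x).cost = (Timed.loop fun i => Timed.loop fun j =>
    Tables.insert (D.seed i j) x (D.table i j)).cost + (1 + 0) := rfl
  rw [e]; push_cast
  have := cost_loop_loop_le fun i j => h.insert (D.seed i j) x (D.table i j)
  linarith

theorem HBE.cost_delete_le (h : HasComplexity H t C) (x : Pt d) (D : HBE H B m) :
    ((D.delete x).cost : ℝ) ≤ B * (m * C) + 1 := by
  have e : (D.delete x).cost = (Timed.loop fun i => Timed.loop fun j =>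
    Tables.delete (D.seed i j) x (D.table i j)).cost + (1 + 0) := rfl
  rw [e]; push_cast
  have := cost_loop_loop_le fun i j => h.delete (D.seed i j) x (D.table i j)
  linarith

theorem HBE.cost_init_le (h : HasComplexity H t C) (ω : Fin B → Fin m → DrawSeed H)
    (X : List (Pt d)) :
    ((HBE.init ω X).cost : ℝ) ≤ B * (m * C) + X.length * (B * (m * C) + 1) := by
  induction X with
  | nil =>
    have e : (HBE.init ω []).cost = (Timed.loop fun _ : Fin B => Timed.loop fun _ : Fin m =>
      Tables.empty (H := H)).cost + 0 := rfl
    rw [e]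
    have := cost_loop_loop_le (B := B) (m := m) fun _ _ => h.draw
    simpa using this
  | cons x X ih =>
    have e : (HBE.init ω (x :: X)).cost =
      (HBE.init ω X).cost + ((HBE.init ω X).val.insert x).cost := rfl
    rw [e, List.length_cons]; push_cast
    have := HBE.cost_insert_le h x (HBE.init ω X).val
    linarith

theorem HBE.cost_query_le (h : HasComplexity H t C) (θ : ℝ) (D : HBE H B m) (q : Pt d) :
    ((D.query t θ q).cost : ℝ) ≤ B * (m * C) + B * m + (B + 1) := by
  have e : (D.query t θ q).cost = (Timed.loop fun i => Timed.loop fun j =>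
    estimate t (D.seed i j) (D.table i j) D.points.length q).cost + (B * m + (B + 1 + 0)) := rfl
  rw [e]; push_cast
  have := cost_loop_loop_le fun i j =>
    h.evaluate (D.seed i j) (D.table i j) D.points.length q
  linarith

theorem one_le_mul_of_hasComplexity (hB : 0 < B) (hm : 0 < m) (h : HasComplexity H t C) :
    (B : ℝ) * m ≤ B * m * C ∧ (B : ℝ) ≤ B * m * C ∧ 1 ≤ B * m * C := by
  have hC := h.one_le
  have hB' : (1 : ℝ) ≤ B := by exact_mod_cast hB
  have hm' : (1 : ℝ) ≤ m := by exact_mod_cast hm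
  have h1 : (B : ℝ) ≤ B * m := le_mul_of_one_le_right (by positivity) hm'
  have h2 : (B : ℝ) * m ≤ B * m * C := le_mul_of_one_le_right (by positivity) hC
  exact ⟨h2, h1.trans h2, hB'.trans (h1.trans h2)⟩

theorem AdamHash.cost_insert_le (hB : 0 < B) (hm : 0 < m) (h : HasComplexity H t C) (x : Pt d) (A : AdamHash H L B m) :
    ((AdamHash.insert x A).cost : ℝ) ≤ 5 * (L * (B * m * C)) := by
  obtain ⟨h1, h2, h3⟩ := one_le_mul_of_hasComplexity hB hm h
  have := cost_loop_le (f := fun j => (A j).insert x) (b := 5 * (B * m * C)) fun j =>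
    (HBE.cost_insert_le h x (A j)).trans (by linarith)
  rw [Fintype.card_fin] at this
  exact this.trans (by linarith)

theorem AdamHash.cost_delete_le (hB : 0 < B) (hm : 0 < m) (h : HasComplexity H t C) (x : Pt d) (A : AdamHash H L B m) :
    ((AdamHash.delete x A).cost : ℝ) ≤ 5 * (L * (B * m * C)) := by
  obtain ⟨h1, h2, h3⟩ := one_le_mul_of_hasComplexity hB hm h
  have := cost_loop_le (f := fun j => (A j).delete x) (b := 5 * (B * m * C)) fun j =>
    (HBE.cost_delete_le h x (A j)).trans (by linarith)
  rw [Fintype.card_fin] at this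
  exact this.trans (by linarith)

theorem AdamHash.cost_init_le (hB : 0 < B) (hm : 0 < m) (h : HasComplexity H t C) (ω : Coins H L B m) {X : List (Pt d)}
    (hX : X ≠ []) :
    ((AdamHash.init ω X).cost : ℝ) ≤ 5 * (L * (B * m * C) * X.length) := by
  obtain ⟨h1, h2, h3⟩ := one_le_mul_of_hasComplexity hB hm h
  have hn : (1 : ℝ) ≤ X.length := by exact_mod_cast List.length_pos_iff.2 hX
  have := cost_loop_le (f := fun j => HBE.init (ω j) X) (b := 5 * (B * m * C * X.length))
    fun j => (HBE.cost_init_le h (ω j) X).trans (by nlinarith)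
  rw [Fintype.card_fin] at this
  exact this.trans (by linarith)

theorem AdamHash.cost_query_le (hB : 0 < B) (hm : 0 < m) (h : HasComplexity H t C) (N : Net d) (θ : ℝ)
    (A : AdamHash H L B m) (q : Pt d) :
    ((AdamHash.query t N θ A q).cost : ℝ) ≤ N.searchCost + 5 * (L * (B * m * C)) := by
  obtain ⟨h1, h2, h3⟩ := one_le_mul_of_hasComplexity hB hm h
  have e : (AdamHash.query t N θ A q).cost = N.searchCost +
    ((Timed.loop fun j => (A j).query t θ (N.locate q)).cost + (L + 0)) := rfl
  rw [e]; push_cast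
  -- Each of the four terms of the HBE query cost is at most `B * m * C`; the outer median over `L`
  -- values accounts for the fifth unit.
  have := cost_loop_le (f := fun j => (A j).query t θ (N.locate q)) (b := 4 * (B * m * C))
    fun j => (HBE.cost_query_le h θ (A j) (N.locate q)).trans (by linarith)
  rw [Fintype.card_fin] at this
  have hL : (L : ℝ) ≤ L * (B * m * C) := le_mul_of_one_le_right (by positivity) h3
  linarith

end Cost

/-! ### The estimator as a random variable -/

section RandomVariable

variable {d G : ℕ} {H : Fin G → HashScheme d}

instance : IsProbabilityMeasure (drawLaw H) := by
  unfold drawLaw; infer_instance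

open Classical in
/-- A quantity that depends on a bucket and on a uniform number is measurable and bounded, if it
is so for every fixed bucket. -/
theorem measurable_filter_collision (S : HashScheme d) (q : Pt d) (X : List (Pt d))
    {Φ : List (Pt d) → unitInterval → ℝ} (hΦ : ∀ l, Measurable (Φ l))
    (hb : ∀ l, ∃ K, ∀ u, |Φ l u| ≤ K) :
    (Measurable fun a : S.Seed × unitInterval =>
      Φ (X.filter fun x => S.dataHash a.1 x = S.queryHash a.1 q) a.2) ∧
    ∃ K, ∀ a : S.Seed × unitInterval,
      |Φ (X.filter fun x => S.dataHash a.1 x = S.queryHash a.1 q) a.2| ≤ K := by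
  -- Hash keys carry no σ-algebra; only collision events are measurable. Splitting on the collision
  -- of `x` leaves the shorter list, with `Φ (x :: ·)` in place of `Φ` on one branch, hence the
  -- generalization.
  induction X generalizing Φ with
  | nil => exact ⟨(hΦ []).comp measurable_snd, (hb []).imp fun K hK a => hK a.2⟩
  | cons x X ih =>
    obtain ⟨m₁, K₁, hK₁⟩ := ih hΦ hb
    obtain ⟨m₂, K₂, hK₂⟩ := ih (Φ := fun l => Φ (x :: l)) (fun l => hΦ _) fun l => hb _
    have e : ∀ a : S.Seed × unitInterval,
        Φ ((x :: X).filter fun x => S.dataHash a.1 x = S.queryHash a.1 q) a.2 =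
        if S.dataHash a.1 x = S.queryHash a.1 q then
          Φ (x :: X.filter fun x => S.dataHash a.1 x = S.queryHash a.1 q) a.2
        else Φ (X.filter fun x => S.dataHash a.1 x = S.queryHash a.1 q) a.2 := by
      intro a
      by_cases h : S.dataHash a.1 x = S.queryHash a.1 q <;> simp [h]
    simp only [e]
    refine ⟨Measurable.ite (measurable_fst (S.measurableSet_collision x q)) m₂ m₁,
      max K₁ K₂, fun a => ?_⟩
    split_ifs
    · exact (hK₂ a).trans (le_max_right _ _)
    · exact (hK₁ a).trans (le_max_left _ _)

/-- The contribution of the `g`-th scheme to the estimator, for a given bucket. -/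
noncomputable def bucketTerm (H : Fin G → HashScheme d) (t : Target d) (q : Pt d) (g : Fin G)
    (l : List (Pt d)) (u : unitInterval) : ℝ :=
  (l[⌊(u : ℝ) * l.length⌋₊]?).elim 0 fun y =>
    hashWeight H g q y * t.w q y / (H g).collisionProb q y * l.length

theorem measurable_bucketTerm (t : Target d) (q : Pt d) (g : Fin G) (l : List (Pt d)) :
    Measurable (bucketTerm H t q g l) := by
  have h : Measurable fun u : unitInterval => ⌊(u : ℝ) * l.length⌋₊ :=
    Nat.measurable_floor.comp (measurable_subtype_coe.mul_const _)
  exact (measurable_from_top (f := fun n : ℕ => (l[n]?).elim 0 fun y =>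
    hashWeight H g q y * t.w q y / (H g).collisionProb q y * l.length)).comp h

theorem exists_abs_bucketTerm_le (t : Target d) (q : Pt d) (g : Fin G) (l : List (Pt d)) :
    ∃ K, ∀ u, |bucketTerm H t q g l u| ≤ K := by
  let f : ℕ → ℝ := fun n => (l[n]?).elim 0 fun y =>
    hashWeight H g q y * t.w q y / (H g).collisionProb q y * l.length
  -- The term depends on `u` only through an index, so finitely many values occur. At `u = 1` the
  -- index is `l.length`, out of range, and the term is `0`.
  refine ⟨∑ n ∈ Finset.range l.length, |f n|, fun u => ?_⟩
  change |f ⌊(u : ℝ) * l.length⌋₊| ≤ _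
  generalize ⌊(u : ℝ) * l.length⌋₊ = n
  by_cases h : n < l.length
  · exact Finset.single_le_sum (f := fun n => |f n|) (fun _ _ => abs_nonneg _)
      (Finset.mem_range.2 h)
  · have : f n = 0 := by simp only [f, List.getElem?_eq_none (not_lt.1 h), Option.elim_none]
    rw [this, abs_zero]
    exact Finset.sum_nonneg fun _ _ => abs_nonneg _

open Classical in
theorem estimator_eq_sum_bucketTerm (t : Target d) (X : List (Pt d)) (q : Pt d) (s : DrawSeed H) :
    estimator t X q s = (∑ g, bucketTerm H t q g
      (X.filter fun x => (H g).dataHash (s g).1 x = (H g).queryHash (s g).1 q) (s g).2) /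
        X.length := by
  have key : ∀ (g : Fin G) (o : Option (Pt d)) (n : ℕ),
      (match o with
        | none => (pure 0 : Timed ℝ)
        | some y => do
          Timed.tick (t.evalCost + ∑ i, (H i).probCost + (2 * G + 4))
          pure (hashWeight H g q y * t.w q y / (H g).collisionProb q y * n)).val =
      o.elim 0 fun y => hashWeight H g q y * t.w q y / (H g).collisionProb q y * n := by
    rintro g (_ | y) n <;> rfl
  exact congrArg (· / (X.length : ℝ)) (Finset.sum_congr rfl fun g _ => key g _ _)

theorem memLp_estimator (t : Target d) (X : List (Pt d)) (q : Pt d) :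
    MemLp (estimator (H := H) t X q) 2 (drawLaw H) := by
  classical
  have key := fun g => measurable_filter_collision (H g) q X
    (measurable_bucketTerm (H := H) t q g) (exists_abs_bucketTerm_le t q g)
  choose hmeas K hK using key
  have e : estimator (H := H) t X q = fun s => _ :=
    funext fun s => estimator_eq_sum_bucketTerm t X q s
  rw [e]
  refine MemLp.of_bound (C := (∑ g, K g) / X.length) ?_ (Filter.Eventually.of_forall fun s => ?_)
  · refine Measurable.aestronglyMeasurable (Measurable.div_const ?_ _)
    exact Finset.measurable_sum _ fun g _ => (hmeas g).comp (measurable_pi_apply g)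
  · rw [Real.norm_eq_abs, abs_div, Nat.abs_cast]
    gcongr
    exact (Finset.abs_sum_le_sum_abs _ _).trans (Finset.sum_le_sum fun g _ => hK g (s g))

end RandomVariable

/-! ### The pairwise mean -/

section PairwiseMean

variable {d : ℕ} {t : Target d} {X : List (Pt d)}

theorem pairwiseMean_mem_Icc
    (ht : ∀ q x, ‖q‖ ≤ 1 → ‖x‖ = 1 → 0 ≤ t.w q x ∧ t.w q x ≤ 1)
    (hX : ∀ x ∈ X, ‖x‖ = 1) {q : Pt d} (hq : ‖q‖ ≤ 1) :
    0 ≤ pairwiseMean t X q ∧ pairwiseMean t X q ≤ 1 := by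
  unfold pairwiseMean
  constructor
  · refine div_nonneg (List.sum_nonneg ?_) (by positivity)
    simp only [List.mem_map, forall_exists_index, and_imp, forall_apply_eq_imp_iff₂]
    exact fun x hx => (ht q x hq (hX x hx)).1
  · refine div_le_one_of_le₀ ?_ (by positivity)
    have := List.sum_le_card_nsmul (X.map fun x => t.w q x) 1 (by
      simp only [List.mem_map, forall_exists_index, and_imp, forall_apply_eq_imp_iff₂]
      exact fun x hx => (ht q x hq (hX x hx)).2)
    simpa using this

theorem abs_pairwiseMean_sub_le {k : ℝ}
    (ht : ∀ q q' x, ‖q‖ ≤ 1 → ‖q'‖ ≤ 1 → ‖x‖ = 1 → |t.w q x - t.w q' x| ≤ k * ‖q - q'‖)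
    (hne : X ≠ []) (hX : ∀ x ∈ X, ‖x‖ = 1) {q q' : Pt d} (hq : ‖q‖ ≤ 1) (hq' : ‖q'‖ ≤ 1) :
    |pairwiseMean t X q - pairwiseMean t X q'| ≤ k * ‖q - q'‖ := by
  have hn : (0 : ℝ) < X.length := by exact_mod_cast List.length_pos_iff.2 hne
  have key : |(X.map fun x => t.w q x).sum - (X.map fun x => t.w q' x).sum| ≤
      X.length * (k * ‖q - q'‖) := by
    clear hne hn
    induction X with
    | nil => simp
    | cons x X ih =>
      have h1 := ht q q' x hq hq' (hX x List.mem_cons_self)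
      have h2 := ih fun x hx => hX x (List.mem_cons_of_mem _ hx)
      simp only [List.map_cons, List.sum_cons, List.length_cons]
      push_cast
      rw [abs_le] at *
      constructor <;> linarith
  unfold pairwiseMean
  rw [← sub_div, abs_div, abs_of_pos hn, div_le_iff₀ hn]
  linarith

end PairwiseMean

/-! ### Correctness -/

/-- A sufficiently good estimate of the value at a nearby point gives a correct answer. -/
theorem isCorrect_cutoff {ε τ μ ν z : ℝ} (hε : 0 < ε) (hε1 : ε < 1) (hτ : 0 < τ)
    (hν : |ν - μ| ≤ ε * τ / 16) (hz : |z - ν| ≤ ε / 16 * max ν τ) :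
    IsCorrect ε τ μ (cutoff ((1 - ε / 2) * τ) z) := by
  have hετ : 0 < ε * τ := by positivity
  have hετ1 : ε * τ < τ := by nlinarith
  rw [abs_le] at hν hz
  -- Here `17 / 256 = (1 / 16) * (17 / 16)`. Together with the shift `ε * τ / 16` the total error is
  -- `33 / 256 * ε * τ`, well below the gap `ε * τ / 2` on either side of the cutoff.
  have hsmall : μ < τ → ε / 16 * max ν τ ≤ ε * τ * (17 / 256) := fun h => by
    have : max ν τ ≤ 17 / 16 * τ := max_le (by linarith) (by linarith)
    nlinarith
  unfold cutoff
  refine ⟨fun h => ?_, fun h => ?_, fun h => ?_⟩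
  · have h1 : ε * τ ≤ ε * μ := by gcongr
    have h2 : ε / 16 * max ν τ ≤ ε * μ * (17 / 256) := by
      have : max ν τ ≤ 17 / 16 * μ := max_le (by linarith) (by linarith)
      nlinarith
    have h3 : (1 - ε / 2) * τ ≤ (1 - ε / 2) * μ := by gcongr; linarith
    rw [if_pos (by linarith), abs_le]
    constructor <;> linarith
  · have h2 := hsmall h
    split_ifs with hc
    · right
      -- A value surviving the cutoff forces `μ` to be comparable to `τ`, which turns the absolute
      -- error into a relative one.
      have h3 : τ / 4 ≤ μ := by linarith
      have h4 : ε * (τ / 4) ≤ ε * μ := by gcongr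
      rw [abs_le]
      constructor <;> linarith
    · exact Or.inl rfl
  · have h2 := hsmall (by linarith)
    rw [if_neg]
    rw [not_le]
    linarith

/-- Above `τ` this is the monotonicity of `V`, below `τ` that of `μ ^ 2 * V μ`. The point `μ = 0`
lies outside `(0, 1]`, but there the factor `μ ^ 2` vanishes. -/
theorem VBounded.variance_le_max {d G : ℕ} {H : Fin G → HashScheme d} {t : Target d} {V : ℝ → ℝ}
    (hV : VBounded H t V) {τ μ : ℝ} (hτ : 0 < τ) (hτ1 : τ < 1) (h0 : 0 ≤ μ) (h1 : μ ≤ 1) :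
    μ ^ 2 * V μ ≤ max μ τ ^ 2 * V τ := by
  have hVτ := hV.nonneg τ
  rcases le_total τ μ with h | h
  · rw [max_eq_left h]
    gcongr
    exact hV.antitone ⟨hτ, hτ1.le⟩ ⟨hτ.trans_le h, h1⟩ h
  · rw [max_eq_right h]
    rcases h0.eq_or_lt with rfl | h0
    · simp only [ne_eq, OfNat.ofNat_ne_zero, not_false_eq_true, zero_pow, zero_mul]
      positivity
    · exact hV.monotone ⟨h0, h1⟩ ⟨hτ, hτ1.le⟩ h

section Failure

variable {d G : ℕ} {H : Fin G → HashScheme d} {t : Target d} {L B m : ℕ}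

open Classical in
/-- For a single query, the median of the answers of the HBEs deviates from the mean only with
exponentially small probability. -/
theorem measure_median_sub_le (hB : 0 < B) (hm : 0 < m) {X : List (Pt d)} {p : Pt d} {v η : ℝ}
    (hv : ProbabilityTheory.variance (estimator (H := H) t X p) (drawLaw H) ≤ v) (hη : 0 < η)
    (hvη : v / (m * η ^ 2) ≤ (1 / 2 ^ 7) ^ 2) :
    coinLaw H L B m {ω | ¬ |(median fun j => median fun i =>
        (∑ l, estimator t X p (ω j i l)) / m) - ∫ s, estimator (H := H) t X p s ∂drawLaw H| ≤ η} ≤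
      ENNReal.ofReal ((1 / 4) ^ L) := by
  set a := ∫ s, estimator (H := H) t X p s ∂drawLaw H with ha
  let bad₀ : Set (Fin m → DrawSeed H) :=
    {ρ | η < |(∑ l, estimator t X p (ρ l)) / m - a|}
  let bad₁ : Set (Fin B → Fin m → DrawSeed H) :=
    {σ | B ≤ 2 * (Finset.univ.filter fun i => σ i ∈ bad₀).card}
  let bad₂ : Set (Coins H L B m) :=
    {ω | L ≤ 2 * (Finset.univ.filter fun j => ω j ∈ bad₁).card}
  have h₀ : Measure.pi (fun _ : Fin m => drawLaw H) bad₀ ≤ ENNReal.ofReal (1 / 2 ^ 7) ^ 2 := by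
    rw [← ENNReal.ofReal_pow (by positivity)]
    exact (measure_pi_mean_sub_le hm (drawLaw H) (memLp_estimator t X p) hv hη).trans
      (ENNReal.ofReal_le_ofReal hvη)
  have two : (2 : ENNReal) = ENNReal.ofReal 2 := by simp
  have h₁ : Measure.pi (fun _ : Fin B => Measure.pi fun _ : Fin m => drawLaw H) bad₁ ≤
      ENNReal.ofReal (1 / 2 ^ 3) ^ 2 := by
    refine (measure_pi_half_le _ bad₀ ?_ h₀).trans ?_
    · rw [ENNReal.ofReal_le_one]; norm_num
    · rw [two, ← ENNReal.ofReal_mul (by norm_num), ← ENNReal.ofReal_pow (by norm_num),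
        ← ENNReal.ofReal_pow (by norm_num)]
      apply ENNReal.ofReal_le_ofReal
      -- The bound `(2⁻⁶) ^ B` is used only through `B ≥ 1`: a constant failure probability per HBE
      -- suffices, as the decay comes from `L`.
      refine (pow_le_pow_of_le_one (by norm_num) (by norm_num) hB).trans ?_
      norm_num
  have h₂ : coinLaw H L B m bad₂ ≤ ENNReal.ofReal ((1 / 4) ^ L) := by
    refine (measure_pi_half_le _ bad₁ ?_ h₁).trans ?_
    · rw [ENNReal.ofReal_le_one]; norm_num
    · rw [two, ← ENNReal.ofReal_mul (by norm_num), ← ENNReal.ofReal_pow (by norm_num)]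
      apply ENNReal.ofReal_le_ofReal
      norm_num
  refine (measure_mono fun ω hω => ?_).trans h₂
  by_contra hgood
  refine hω ?_
  have mem_iff : ∀ z, z ∈ Set.Icc (a - η) (a + η) ↔ |z - a| ≤ η := fun z => by
    rw [Set.mem_Icc, abs_le]
    constructor <;> rintro ⟨h, h'⟩ <;> constructor <;> linarith
  rw [← mem_iff]
  refine median_mem_Icc (lt_of_le_of_lt ?_ (not_le.1 hgood))
  gcongr with j
  intro hj
  by_contra hgood₁
  refine hj (median_mem_Icc (lt_of_le_of_lt ?_ (not_le.1 hgood₁)))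
  gcongr with i
  intro hi
  change η < _
  rw [mem_iff] at hi
  exact not_le.1 hi

variable {N : Net d} {k ε τ δ ε₀ : ℝ} {V : ℝ → ℝ} {X : List (Pt d)} {us : List (Update d)}

theorem measure_not_isCorrect_le (hB : 0 < B) (hm : 0 < m) (hL : 0 < L)
    (hε : 0 < ε) (hε1 : ε < 1) (hτ : 0 < τ) (hτ1 : τ < 1)
    (hk : 0 ≤ k) (hε₀ : k * ε₀ ≤ ε * τ / 16)
    (hmV : 2 ^ 22 * (ε⁻¹ ^ 2 * V τ) ≤ m)
    (hLN : (10 / ε₀) ^ d * (1 / 4) ^ L ≤ δ) (hN : N.IsNet ε₀)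
    (ht : ∀ q x, ‖q‖ ≤ 1 → ‖x‖ = 1 → 0 ≤ t.w q x ∧ t.w q x ≤ 1)
    (ht' : ∀ q q' x, ‖q‖ ≤ 1 → ‖q'‖ ≤ 1 → ‖x‖ = 1 → |t.w q x - t.w q' x| ≤ k * ‖q - q'‖)
    (hV : VBounded H t V) (hX : ∀ x ∈ X, ‖x‖ = 1) (hus : ∀ u ∈ us, ‖u.point‖ = 1)
    (hne : dataAfter X us ≠ []) :
    coinLaw H L B m {ω | ¬ ∀ q : Pt d, ‖q‖ ≤ 1 →
      IsCorrect ε τ (pairwiseMean t (dataAfter X us) q)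
        (AdamHash.query t N ((1 - ε / 2) * τ) (stateAfter ω X us) q).val} ≤
      ENNReal.ofReal δ := by
  have hY := norm_eq_one_of_mem_dataAfter hX hus
  simp only [query_stateAfter]
  generalize dataAfter X us = Y at hne hY ⊢
  have hm' : (0 : ℝ) < m := by exact_mod_cast hm
  let fail : Pt d → Set (Coins H L B m) := fun p => {ω | ¬ |(median fun j => median fun i =>
    (∑ l, estimator t Y p (ω j i l)) / m) - pairwiseMean t Y p| ≤
      ε / 16 * max (pairwiseMean t Y p) τ}
  have hfail : ∀ p ∈ N.points, coinLaw H L B m (fail p) ≤ ENNReal.ofReal ((1 / 4) ^ L) := by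
    intro p hp
    have hp1 := hN.norm_le p hp
    obtain ⟨h0, h1⟩ := pairwiseMean_mem_Icc ht hY hp1
    have hM : 0 < max (pairwiseMean t Y p) τ := lt_max_of_lt_right hτ
    have := measure_median_sub_le (H := H) (t := t) (L := L) hB hm (X := Y) (p := p)
      (v := max (pairwiseMean t Y p) τ ^ 2 * V τ) (η := ε / 16 * max (pairwiseMean t Y p) τ)
      ((hV.variance_le Y hne hY p hp1).trans (hV.variance_le_max hτ hτ1 h0 h1))
      (by positivity) ?_
    · rwa [hV.unbiased Y hne hY p hp1] at this
    · rw [div_le_iff₀ (by positivity)]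
      set M := max (pairwiseMean t Y p) τ
      -- Chebyshev's bound is `256 * V τ / (m * ε ^ 2)`; with `m ≥ 2 ^ 22 * V τ / ε ^ 2` it is at
      -- most `2⁻¹⁴ = (2⁻⁷) ^ 2`.
      have e : V τ = ε ^ 2 * (ε⁻¹ ^ 2 * V τ) := by field_simp
      calc M ^ 2 * V τ = M ^ 2 * ε ^ 2 * (ε⁻¹ ^ 2 * V τ) := by rw [mul_assoc, ← e]
        _ ≤ M ^ 2 * ε ^ 2 * (m / 2 ^ 22) := by
          gcongr
          rw [le_div_iff₀ (by positivity)]; linarith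
        _ = _ := by ring
  have hsub : {ω : Coins H L B m | ¬ ∀ q : Pt d, ‖q‖ ≤ 1 → IsCorrect ε τ (pairwiseMean t Y q)
      (median (cutoff ((1 - ε / 2) * τ) ∘ fun j => median fun i =>
        (∑ l, estimator t Y (N.locate q) (ω j i l)) / m))} ⊆
      ⋃ p ∈ hN.finite.toFinset, fail p := by
    intro ω hω
    by_contra hgood
    refine hω fun q hq => ?_
    have hp := hN.locate_mem q hq
    have hclose : |(median fun j => median fun i =>
        (∑ l, estimator t Y (N.locate q) (ω j i l)) / m) - pairwiseMean t Y (N.locate q)| ≤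
        ε / 16 * max (pairwiseMean t Y (N.locate q)) τ := by
      by_contra hbad
      exact hgood (Set.mem_iUnion₂.2 ⟨N.locate q, by simpa using hp, hbad⟩)
    rw [median_comp hL (cutoff_monotone (mul_nonneg (by linarith) hτ.le))]
    refine isCorrect_cutoff hε hε1 hτ ?_ hclose
    refine (abs_pairwiseMean_sub_le ht' hne hY (hN.norm_le _ hp) hq).trans ?_
    have := hN.dist_locate_le q hq
    rw [dist_comm, dist_eq_norm] at this
    exact (mul_le_mul_of_nonneg_left this hk).trans hε₀
  refine (measure_mono hsub).trans <| (measure_biUnion_finset_le _ _).trans ?_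
  calc ∑ p ∈ hN.finite.toFinset, coinLaw H L B m (fail p)
      ≤ ∑ _p ∈ hN.finite.toFinset, ENNReal.ofReal ((1 / 4) ^ L) :=
        Finset.sum_le_sum fun p hp => hfail p (by simpa using hp)
    _ = ENNReal.ofReal (N.points.ncard * (1 / 4) ^ L) := by
        rw [Finset.sum_const, nsmul_eq_mul, ENNReal.ofReal_mul (by positivity),
          ENNReal.ofReal_natCast, Set.ncard_eq_toFinset_card _ hN.finite]
    _ ≤ ENNReal.ofReal δ := by
        apply ENNReal.ofReal_le_ofReal
        refine le_trans ?_ hLN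
        gcongr
        exact hN.card_le

end Failure

/-! ### The sizes -/

/-- Rounding up costs only constant factors: `log (1 / δ)` is bounded below in terms of `δ₀`, and `ε
^ 2 ≤ v` makes `ε⁻¹ ^ 2 * v` at least `1`. For `δ₀ ≤ 0` there is no admissible `δ`. -/
theorem exists_sizes {δ₀ : ℝ} (hδ₀ : δ₀ < 1) :
    ∃ K : ℝ, 0 < K ∧ ∀ {d : ℕ} {k ε τ δ v : ℝ},
      0 < d → 0 < ε → 0 < τ → 0 < δ → δ ≤ δ₀ → ε * τ ≤ k → ε ^ 2 ≤ v →
      ∃ L B m : ℕ, 0 < L ∧ 0 < B ∧ 0 < m ∧ 2 ^ 22 * (ε⁻¹ ^ 2 * v) ≤ m ∧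
        (L : ℝ) ≤ 4 * Real.log ((10 * k / (ε * τ)) ^ d / δ) ∧
        (B : ℝ) * m ≤ K * (ε⁻¹ ^ 2 * v * Real.log (1 / δ)) ∧
        1 ≤ K * (ε⁻¹ ^ 2 * v * Real.log (1 / δ)) ∧
        (d : ℝ) ≤ Real.log ((10 * k / (ε * τ)) ^ d / δ) ∧
        (10 / (ε * τ / (16 * k))) ^ d * (1 / 4) ^ L ≤ δ := by
  rcases le_or_gt δ₀ 0 with h | hpos
  · exact ⟨1, one_pos, fun _ _ _ hδ hδ' => absurd hδ' (by linarith)⟩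
  set ℓ := Real.log (1 / δ₀) with hℓ
  have hℓ0 : 0 < ℓ := Real.log_pos (by rw [lt_div_iff₀ hpos]; linarith)
  refine ⟨(1 + 1 / ℓ) * (2 ^ 22 + 1), by positivity, ?_⟩
  intro d k ε τ δ v hd hε hτ hδ hδ' hk hv
  have hετ : 0 < ε * τ := by positivity
  have hk0 : 0 < k := hετ.trans_le hk
  set u := ε⁻¹ ^ 2 * v with hu
  have hu1 : 1 ≤ u := by
    calc (1 : ℝ) = ε⁻¹ ^ 2 * ε ^ 2 := by field_simp
      _ ≤ u := by rw [hu]; gcongr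
  set lg := Real.log (1 / δ) with hlg
  have hlg0 : ℓ ≤ lg := Real.log_le_log (by positivity) (by gcongr)
  have hlgpos : 0 < lg := hℓ0.trans_le hlg0
  have hone : 1 ≤ 1 / ℓ * lg := by
    rw [one_div, ← div_eq_inv_mul, le_div_iff₀ hℓ0]; linarith
  set Q := 10 * k / (ε * τ) with hQ
  have hQ10 : 10 ≤ Q := by rw [hQ, le_div_iff₀ hετ]; linarith
  have hlogQ : 2 ≤ Real.log Q := by
    rw [Real.le_log_iff_exp_le (by linarith)]
    have h1 := Real.exp_one_lt_d9
    have : Real.exp 2 = Real.exp 1 * Real.exp 1 := by rw [← Real.exp_add]; norm_num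
    rw [this]; nlinarith [Real.exp_pos 1]
  have hΛ : Real.log (Q ^ d / δ) = d * Real.log Q + lg := by
    rw [Real.log_div (by positivity) hδ.ne', Real.log_pow, hlg, one_div, Real.log_inv]; ring
  set Λ := Real.log (Q ^ d / δ)
  have hd1 : (1 : ℝ) ≤ d := by exact_mod_cast hd
  have hdΛ : 2 * (d : ℝ) ≤ Λ := by rw [hΛ]; nlinarith
  -- The factor `3` covers the net: its size is at most `(16 * Q) ^ d`, and `log 16 ≤ 2 * log Q`
  -- because `Q ≥ 10`. Moreover `log 4 ≥ 1`, so `4⁻ᴸ ≤ exp (-3 * Λ)`.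
  refine ⟨⌈3 * Λ⌉₊, ⌈lg⌉₊, ⌈2 ^ 22 * u⌉₊, Nat.ceil_pos.2 (by linarith), Nat.ceil_pos.2 hlgpos,
    Nat.ceil_pos.2 (by positivity), Nat.le_ceil _, ?_, ?_, ?_, by linarith, ?_⟩
  · linarith [Nat.ceil_lt_add_one (show 0 ≤ 3 * Λ by linarith)]
  · calc (⌈lg⌉₊ : ℝ) * ⌈2 ^ 22 * u⌉₊ ≤ (lg + 1 / ℓ * lg) * (2 ^ 22 * u + u) := by
          gcongr
          · linarith [Nat.ceil_lt_add_one hlgpos.le]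
          · linarith [Nat.ceil_lt_add_one (show 0 ≤ 2 ^ 22 * u by positivity)]
      _ = _ := by ring
  · have h1 : 1 ≤ (1 + 1 / ℓ) * lg := by linarith
    have h2 : 1 ≤ (2 ^ 22 + 1) * u := by linarith
    calc (1 : ℝ) ≤ ((1 + 1 / ℓ) * lg) * ((2 ^ 22 + 1) * u) := one_le_mul_of_one_le_of_one_le h1 h2
      _ = _ := by ring
  · have hbase : 10 / (ε * τ / (16 * k)) = 16 * Q := by rw [hQ]; field_simp
    rw [hbase, ← Real.log_le_log_iff (by positivity) hδ,
      Real.log_mul (by positivity) (by positivity), Real.log_pow, Real.log_pow,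
      Real.log_mul (by norm_num) (by positivity), one_div, Real.log_inv]
    have h16 : Real.log 16 = 4 * Real.log 2 := by
      rw [show (16 : ℝ) = 2 ^ 4 by norm_num, Real.log_pow]; norm_num
    have h4 : Real.log 4 = 2 * Real.log 2 := by
      rw [show (4 : ℝ) = 2 ^ 2 by norm_num, Real.log_pow]; norm_num
    have hl2 := Real.log_two_lt_d9
    have hl2' := Real.log_two_gt_d9
    have hδlog : Real.log δ = -lg := by rw [hlg, one_div, Real.log_inv, neg_neg]
    rw [h16, h4, hδlog]
    have hL : 3 * Λ ≤ ⌈3 * Λ⌉₊ := Nat.le_ceil _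
    have h5 : 3 * Λ * 1 ≤ (⌈3 * Λ⌉₊ : ℝ) * (2 * Real.log 2) := by
      gcongr
      linarith
    have h6 : (d : ℝ) * (4 * Real.log 2 + Real.log Q) ≤ d * (3 * Real.log Q) := by
      gcongr
      linarith
    have h7 : (d : ℝ) * (3 * Real.log Q) = 3 * (d * Real.log Q) := by ring
    rw [h7] at h6
    linarith

/-! ### The main theorem -/

theorem mainTheorem3 (δ₀ : ℝ) (hδ₀ : δ₀ < 1) :
    ∃ c : ℝ, 0 < c ∧
    ∀ (d : ℕ) (k ε τ δ : ℝ) (V : ℝ → ℝ),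
      0 < d → 0 < ε → ε < 1 → 0 < τ → τ < 1 → 0 < δ → δ ≤ δ₀ → ε * τ ≤ k → ε ^ 2 ≤ V τ →
    ∃ (ε₀ : ℝ) (L B m : ℕ),
      0 < ε₀ ∧ ε₀ ≤ ε * τ / k ∧
      (L : ℝ) ≤ c * Real.log ((10 * k / (ε * τ)) ^ d / δ) ∧
      (B : ℝ) * m ≤ c * (ε⁻¹ ^ 2 * V τ * Real.log (1 / δ)) ∧
      (gridNet d ε₀).IsNet ε₀ ∧
      ∀ N : Net d, N.IsNet ε₀ →
      ∀ (G : ℕ) (H : Fin G → HashScheme d) (t : Target d),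
        (∀ q x, ‖q‖ ≤ 1 → ‖x‖ = 1 → 0 ≤ t.w q x ∧ t.w q x ≤ 1) →
        (∀ q q' x, ‖q‖ ≤ 1 → ‖q'‖ ≤ 1 → ‖x‖ = 1 → |t.w q x - t.w q' x| ≤ k * ‖q - q'‖) →
        VBounded H t V →
        -- Correctness, after any fixed sequence of updates:
        (∀ (X : List (Pt d)) (us : List (Update d)),
          X ≠ [] → (∀ x ∈ X, ‖x‖ = 1) → (∀ u ∈ us, ‖u.point‖ = 1) → dataAfter X us ≠ [] →
          -- with probability at least `1 - δ`, for all queries in the unit ball at once,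
          coinLaw H L B m {ω | ¬ ∀ q : Pt d, ‖q‖ ≤ 1 →
            IsCorrect ε τ (pairwiseMean t (dataAfter X us) q)
              (AdamHash.query t N ((1 - ε / 2) * τ) (stateAfter ω X us) q).val}
            ≤ ENNReal.ofReal δ ∧
          -- and with probability at least `1 - δ`, for all the queries of an adaptive adversary.
          ∀ adversary : List ℝ → Pt d, (∀ l, ‖adversary l‖ ≤ 1) →
            coinLaw H L B m {ω | ¬ ∀ i : ℕ,
              let answer : Pt d → ℝ := fun q =>
                (AdamHash.query t N ((1 - ε / 2) * τ) (stateAfter ω X us) q).val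
              let q := adversary (adaptiveAnswers answer adversary i)
              IsCorrect ε τ (pairwiseMean t (dataAfter X us) q) (answer q)}
              ≤ ENNReal.ofReal δ) ∧
        -- Running times, in the worst case over the random choices and the state:
        (∀ C : ℝ, HasComplexity H t C →
          (∀ (ω : Coins H L B m) (X : List (Pt d)), X ≠ [] → (∀ x ∈ X, ‖x‖ = 1) →
            ((AdamHash.init ω X).cost : ℝ) ≤
              c * (ε⁻¹ ^ 2 * V τ * C * Real.log (1 / δ) * X.length *
                Real.log ((10 * k / (ε * τ)) ^ d / δ))) ∧
          (∀ (A : AdamHash H L B m) (q : Pt d),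
            ((AdamHash.query t N ((1 - ε / 2) * τ) A q).cost : ℝ) ≤
              N.searchCost + c * (ε⁻¹ ^ 2 * V τ * C * Real.log (1 / δ) *
                Real.log ((10 * k / (ε * τ)) ^ d / δ))) ∧
          (N.searchCost ≤ d → ∀ (A : AdamHash H L B m) (q : Pt d),
            ((AdamHash.query t N ((1 - ε / 2) * τ) A q).cost : ℝ) ≤
              c * (ε⁻¹ ^ 2 * V τ * C * Real.log (1 / δ) *
                Real.log ((10 * k / (ε * τ)) ^ d / δ))) ∧
          (∀ (A : AdamHash H L B m) (x : Pt d),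
            ((AdamHash.insert x A).cost : ℝ) ≤
              c * (ε⁻¹ ^ 2 * V τ * C * Real.log (1 / δ) *
                Real.log ((10 * k / (ε * τ)) ^ d / δ))) ∧
          (∀ (A : AdamHash H L B m) (x : Pt d),
            ((AdamHash.delete x A).cost : ℝ) ≤
              c * (ε⁻¹ ^ 2 * V τ * C * Real.log (1 / δ) *
                Real.log ((10 * k / (ε * τ)) ^ d / δ)))) := by
  obtain ⟨K, hK, hsizes⟩ := exists_sizes hδ₀
  -- `20 * K` pays for the work on the estimators (`5` per unit, times `L ≤ 4 * Λ`), `K` for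
  -- locating the net point within `d ≤ Λ` steps, and `4` for the bound on `L`.
  refine ⟨20 * K + K + 4, by positivity, ?_⟩
  intro d k ε τ δ V hd hε hε1 hτ hτ1 hδ hδ' hk hv
  obtain ⟨L, B, m, hL0, hB0, hm0, hm, hL, hBm, hone, hdΛ, hLN⟩ := hsizes hd hε hτ hδ hδ' hk hv
  set Λ := Real.log ((10 * k / (ε * τ)) ^ d / δ)
  set lg := Real.log (1 / δ)
  set u := ε⁻¹ ^ 2 * V τ
  have hετ : 0 < ε * τ := by positivity
  have hk0 : 0 < k := hετ.trans_le hk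
  have hd1 : (1 : ℝ) ≤ d := by exact_mod_cast hd
  have hΛ : 0 < Λ := by linarith
  have hu : 0 < u * lg := by
    by_contra! h
    nlinarith
  refine ⟨ε * τ / (16 * k), L, B, m, by positivity, ?_, ?_, ?_,
    gridNet_isNet hd (by positivity) ?_, ?_⟩
  · gcongr; linarith
  · exact hL.trans (by gcongr; linarith)
  · exact hBm.trans (by gcongr; linarith)
  · rw [div_le_one₀ (by positivity)]; linarith
  intro N hN G H t ht ht' hV
  refine ⟨fun X us hX hX1 hus hne => ?_, fun C hC => ?_⟩
  · have h := measure_not_isCorrect_le (X := X) hB0 hm0 hL0 hε hε1 hτ hτ1 hk0.le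
      (le_of_eq (by field_simp)) hm hLN hN ht ht' hV hX1 hus hne
    refine ⟨h, fun adversary hadv => (measure_mono fun ω hω => ?_).trans h⟩
    -- Once `ω` is fixed, the answers are a deterministic function of the query, so each adaptive
    -- query is just one point of the ball.
    exact fun hcorrect => hω fun i => hcorrect _ (hadv _)
  · have hC1 := hC.one_le
    have hmain : 5 * (L * (B * m * C)) ≤ 20 * K * (u * C * lg * Λ) := by
      calc 5 * (L * (B * m * C)) ≤ 5 * (4 * Λ * (K * (u * lg) * C)) := by gcongr
        _ = _ := by ring
    have hpos : 0 < u * C * lg * Λ := by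
      have : u * C * lg * Λ = (u * lg) * (C * Λ) := by ring
      rw [this]; positivity
    have hstep : 20 * K * (u * C * lg * Λ) ≤ (20 * K + K + 4) * (u * C * lg * Λ) := by
      gcongr; linarith
    have hlocate : (d : ℝ) ≤ K * (u * C * lg * Λ) := by
      have h1 : 1 * Λ ≤ (K * (u * lg) * C) * Λ := by
        gcongr
        exact one_le_mul_of_one_le_of_one_le hone hC1
      linarith
    refine ⟨fun ω X hX _ => ?_, fun A q => ?_, fun hs A q => ?_, fun A x => ?_, fun A x => ?_⟩
    · refine (AdamHash.cost_init_le hB0 hm0 hC ω hX).trans ?_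
      calc 5 * (L * (B * m * C) * X.length) = 5 * (L * (B * m * C)) * X.length := by ring
        _ ≤ (20 * K + K + 4) * (u * C * lg * Λ) * X.length :=
          mul_le_mul_of_nonneg_right (hmain.trans hstep) (Nat.cast_nonneg _)
        _ = _ := by ring
    · linarith [AdamHash.cost_query_le hB0 hm0 hC N ((1 - ε / 2) * τ) A q]
    · have hs' : (N.searchCost : ℝ) ≤ d := by exact_mod_cast hs
      have := AdamHash.cost_query_le hB0 hm0 hC N ((1 - ε / 2) * τ) A q
      linarith
    · exact (AdamHash.cost_insert_le hB0 hm0 hC x A).trans (hmain.trans hstep)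
    · exact (AdamHash.cost_delete_le hB0 hm0 hC x A).trans (hmain.trans hstep)
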